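/- Let $T>0$, let $\ell\ge 1$ be an integer, let $0<\alpha_\ell<\dots<\alpha_2<\alpha_1\le 1$, let $\lambda\ge 0$, and let $q_1,\dots,q_\ell\in C[0,T]$ satisfy $q_i(t)\ge 0$ for each $i$ and $\sum_{i=1}^{\ell}q_i(t)>0$ for all $t\in[0,T]$. Let $v\in C[0,T]$ with $v\ge 0$, and let $w_0\ge 0$. Suppose that $w\in C[0,T]\cap W^{1,\infty}(\epsilon,t)$ whenever $0<\epsilon<t\le T$ (equivalently, $w$ is continuous on $[0,T]$ and Lipschitz continuous on each such $[\epsilon,t]$), and, if $\alpha_1=1$, suppose also that $w\in C^1(0,T]$. Suppose that $w$ solves the initial-value problem \[ \sum_{i=1}^{\ell}q_i(t)\,D_t^{\alpha_i}w(t)+\lambda w(t)=v(t)\quad\text{for }0<t\le T,\qquad w(0)=w_0, \] where, for $0<\alpha<1$, the Caputo derivative is defined by \[ \Gamma(1-\alpha)\,D_t^{\alpha}w(t)=t^{-\alpha}\,[w(t)-w(0)]+\int_0^t\alpha\,(t-s)^{-\alpha-1}\,[w(t)-w(s)]\,ds , \] and $D_t^{1}w=w'$ (at $t=T$ the one-sided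 derivative). Set $\underline q_j=\min_{t\in[0,T]}q_j(t)$ for $j=1,\dots,\ell$, and let $E_{\alpha,1}(s)=\sum_{k=0}^{\infty}s^k/\Gamma(\alpha k+1)$ be the Mittag-Leffler function. Then \[ w(t)\ \ge\ w_0\,\max_{j=1,\dots,\ell}E_{\alpha_j,1}\!\left(-\lambda t^{\alpha_j}/\underline q_j\right)\qquad\text{for all }t\in[0,T], \] where $E_{\alpha_j,1}(-\lambda t^{\alpha_j}/\underline q_j)$ is set identically equal to $0$ if $\underline q_j=0$. -/

import Mathlib

open Set

noncomputable section

/-- The two-parameter Mittag-Leffler function `E_{α,β}(s) = ∑_{k ≥ 0} s^k / Γ(α k + β)`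
(the series converges for every real `s` when `α > 0`). -/
def mittagLeffler (α β s : ℝ) : ℝ :=
  ∑' k : ℕ, s ^ k / Real.Gamma (α * k + β)

/-- Regularity: `y ∈ C[0,T]`, and `y ∈ W^{1,∞}(ε,t)`, i.e. `y` is Lipschitz continuous on
`[ε,t]`, whenever `0 < ε < t ≤ T`. -/
def CaputoRegular (T : ℝ) (y : ℝ → ℝ) : Prop :=
  ContinuousOn y (Icc 0 T) ∧
    ∀ ε t : ℝ, 0 < ε → ε < t → t ≤ T → ∃ K : NNReal, LipschitzOnWith K y (Icc ε t)

/-- The derivative `D_t^α y(t)` for `0 < α ≤ 1` and `0 < t ≤ T`. For `α < 1` it is the Caputo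
derivative in the form
`Γ(1-α) D_t^α y(t) = t^{-α} (y(t) - y(0)) + ∫_0^t α (t-s)^{-α-1} (y(t) - y(s)) ds`;
for `α = 1` it is the ordinary derivative `y'(t)` on `(0,T]` (one-sided at `t = T`). -/
def caputoDeriv (T α : ℝ) (y : ℝ → ℝ) (t : ℝ) : ℝ :=
  if α = 1 then derivWithin y (Ioc 0 T) t
  else (Real.Gamma (1 - α))⁻¹ *
    (t ^ (-α) * (y t - y 0) + ∫ s in (0 : ℝ)..t, α * (t - s) ^ (-α - 1) * (y t - y s))

/-- `w` solves `∑ i, q_i(t) D_t^{α_i} w(t) + lam * w(t) = v(t)` for `0 < t ≤ T`, `w(0) = w₀`. -/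
def SolvesIVP {ℓ : ℕ} (T : ℝ) (α : Fin ℓ → ℝ) (q : Fin ℓ → ℝ → ℝ) (lam : ℝ) (v : ℝ → ℝ)
    (w₀ : ℝ) (w : ℝ → ℝ) : Prop :=
  (∀ t ∈ Ioc 0 T, ∑ i, q i t * caputoDeriv T (α i) w t + lam * w t = v t) ∧ w 0 = w₀

/-- The minimum of `f` over `[0,T]`, for `f` continuous and `0 ≤ T`. -/
def minValue (T : ℝ) (f : ℝ → ℝ) : ℝ := sInf (f '' Icc 0 T)

theorem minValue_isLeast {T : ℝ} (hT : 0 ≤ T) {f : ℝ → ℝ} (hf : ContinuousOn f (Icc 0 T)) :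
    IsLeast (f '' Icc 0 T) (minValue T f) :=
  (isCompact_Icc.image_of_continuousOn hf).isLeast_sInf ((nonempty_Icc.2 hT).image f)

/-- The function `t ↦ E_{α,1}(-lam t^α / m)`, set to be identically `0` if `m = 0`. -/
def lowerBarrier (α lam m t : ℝ) : ℝ :=
  if m = 0 then 0 else mittagLeffler α 1 (-lam * t ^ α / m)

end

/-! Fix `j` with minimum `m > 0` of `q j`, and put `c = lam / m`, `u(t) = E_{α_j,1}(-c t^{α_j})`.
Then `D^{α_j} u = -c u`. If `u` is nonincreasing, every `D^{α_i} u` is nonpositive, so dropping the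
terms `i ≠ j` and replacing `q j` by `m` can only increase the sum: `∑ q_i D^{α_i} u + lam u ≤ m
D^{α_j} u + lam u = 0`. Hence `w - w₀ u` starts at `0` and has nonnegative image under the operator,
and a comparison principle gives `w ≥ w₀ u`.

Comparison (`nonneg_of_sum_caputoDeriv_nonneg`) is a minimum principle: the Caputo derivative is
nonpositive at a point minimal over its past. Monotonicity of `u` also follows from its equation
(`antitoneOn_of_caputoDeriv_eq`), and the equation (`caputoDeriv_mittagLeffler_rpow`) by termwise
differentiation. -/

theorem CaputoRegular.exists_abs_sub_le {T : ℝ} {y : ℝ → ℝ} (hy : CaputoRegular T y) {t : ℝ}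
    (ht : t ∈ Ioc 0 T) : ∃ K : ℝ, 0 ≤ K ∧ ∀ s ∈ Icc 0 t, |y t - y s| ≤ K * (t - s) := by
  have ht0 : 0 < t := ht.1
  obtain ⟨K, hK⟩ := hy.2 (t / 2) t (by linarith) (by linarith) ht.2
  obtain ⟨M, hM⟩ := isCompact_Icc.exists_bound_of_continuousOn hy.1
  have hM0 : 0 ≤ M := (norm_nonneg _).trans (hM t ⟨ht.1.le, ht.2⟩)
  -- The Lipschitz bound may fail near `0`; for `s ≤ t/2` the increment is at most `2M`, while `t -
  -- s ≥ t/2`.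
  refine ⟨K + 4 * M / t, by positivity, fun s hs => ?_⟩
  rcases le_total (t / 2) s with h | h
  · have := hK.dist_le_mul t ⟨by linarith, le_rfl⟩ s ⟨h, hs.2⟩
    rw [Real.dist_eq, Real.dist_eq, abs_of_nonneg (sub_nonneg.2 hs.2)] at this
    have h2 : 0 ≤ 4 * M / t * (t - s) := mul_nonneg (by positivity) (sub_nonneg.2 hs.2)
    linarith
  · have h1 := hM t ⟨ht.1.le, ht.2⟩
    have h2 := hM s ⟨hs.1, hs.2.trans ht.2⟩
    rw [Real.norm_eq_abs] at h1 h2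
    have h3 : |y t - y s| ≤ 2 * M := (abs_sub _ _).trans (by linarith)
    have h4 : 2 * M ≤ 4 * M / t * (t - s) := by
      rw [div_mul_eq_mul_div, le_div_iff₀ ht0]
      nlinarith
    have h5 : 0 ≤ (K : ℝ) * (t - s) := mul_nonneg K.2 (sub_nonneg.2 hs.2)
    linarith

theorem intervalIntegrable_sub_rpow {r : ℝ} (hr : -1 < r) (t : ℝ) :
    IntervalIntegrable (fun s => (t - s) ^ r) MeasureTheory.volume 0 t := by
  have := (intervalIntegral.intervalIntegrable_rpow' (a := 0) (b := t) hr).comp_sub_left t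
  simpa using this.symm

/-- The linear bound on increments cancels one power of the kernel, leaving a multiple of `(t -
s)^(-α)`. -/
theorem CaputoRegular.intervalIntegrable {T α : ℝ} {y : ℝ → ℝ} (hy : CaputoRegular T y)
    (hα1 : α < 1) {t : ℝ} (ht : t ∈ Ioc 0 T) :
    IntervalIntegrable (fun s => α * (t - s) ^ (-α - 1) * (y t - y s))
      MeasureTheory.volume 0 t := by
  obtain ⟨K, hK0, hK⟩ := hy.exists_abs_sub_le ht
  have hint : IntervalIntegrable (fun s => |α| * K * (t - s) ^ (-α)) MeasureTheory.volume 0 t :=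
    (intervalIntegrable_sub_rpow (by linarith) t).const_mul _
  rw [intervalIntegrable_iff_integrableOn_Ioo_of_le ht.1.le] at hint ⊢
  have hc : ContinuousOn (fun s => α * (t - s) ^ (-α - 1) * (y t - y s)) (Ioo 0 t) := by
    refine (continuousOn_const.mul ((continuousOn_const.sub continuousOn_id).rpow_const ?_)).mul
      (continuousOn_const.sub (hy.1.mono ?_))
    · intro s hs
      exact Or.inl (sub_pos.2 hs.2).ne'
    · exact fun s hs => ⟨hs.1.le, hs.2.le.trans ht.2⟩
  refine hint.mono' (hc.aestronglyMeasurable measurableSet_Ioo) ?_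
  refine (MeasureTheory.ae_restrict_iff' measurableSet_Ioo).2 (.of_forall fun s hs => ?_)
  have hts : 0 < t - s := sub_pos.2 hs.2
  have h1 := hK s ⟨hs.1.le, hs.2.le⟩
  have h2 : (t - s) ^ (-α) = (t - s) ^ (-α - 1) * (t - s) := by
    rw [← Real.rpow_add_one hts.ne']; congr 1; ring
  have h3 : 0 ≤ (t - s) ^ (-α - 1) := by positivity
  rw [Real.norm_eq_abs, abs_mul, abs_mul, abs_of_nonneg h3, h2]
  calc |α| * (t - s) ^ (-α - 1) * |y t - y s|
      ≤ |α| * (t - s) ^ (-α - 1) * (K * (t - s)) := by gcongr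
    _ = _ := by ring

/-! ### Linearity -/

theorem CaputoRegular.add {T : ℝ} {y z : ℝ → ℝ} (hy : CaputoRegular T y)
    (hz : CaputoRegular T z) : CaputoRegular T (fun t => y t + z t) := by
  refine ⟨hy.1.add hz.1, fun ε t h0 h1 h2 => ?_⟩
  obtain ⟨K, hK⟩ := hy.2 ε t h0 h1 h2
  obtain ⟨K', hK'⟩ := hz.2 ε t h0 h1 h2
  exact ⟨K + K', hK.add hK'⟩

theorem CaputoRegular.const_mul {T : ℝ} {y : ℝ → ℝ} (hy : CaputoRegular T y) (c : ℝ) :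
    CaputoRegular T (fun t => c * y t) := by
  refine ⟨hy.1.const_smul c, fun ε t h0 h1 h2 => ?_⟩
  obtain ⟨K, hK⟩ := hy.2 ε t h0 h1 h2
  refine ⟨‖c‖₊ * K, LipschitzOnWith.of_dist_le_mul fun a ha b hb => ?_⟩
  have := hK.dist_le_mul a ha b hb
  rw [Real.dist_eq] at this ⊢
  rw [← mul_sub, abs_mul, NNReal.coe_mul, coe_nnnorm, Real.norm_eq_abs, mul_assoc]
  gcongr

theorem ContDiffOn.caputoRegular {T : ℝ} {y : ℝ → ℝ} (hc : ContinuousOn y (Icc 0 T))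
    (hd : ContDiffOn ℝ 1 y (Ioi 0)) : CaputoRegular T y := by
  refine ⟨hc, fun ε t h0 h1 _ => ?_⟩
  have hsub : Icc ε t ⊆ Ioi 0 := fun s hs => h0.trans_le hs.1
  have hd' := hd.mono hsub
  exact hd'.exists_lipschitzOnWith one_ne_zero (convex_Icc ε t) isCompact_Icc

theorem caputoDeriv_add {T α : ℝ} {y z : ℝ → ℝ} (hα1 : α ≤ 1) (hy : CaputoRegular T y)
    (hz : CaputoRegular T z) (hy' : α = 1 → DifferentiableOn ℝ y (Ioc 0 T))
    (hz' : α = 1 → DifferentiableOn ℝ z (Ioc 0 T)) {t : ℝ} (ht : t ∈ Ioc 0 T) :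
    caputoDeriv T α (fun t => y t + z t) t = caputoDeriv T α y t + caputoDeriv T α z t := by
  unfold caputoDeriv
  split_ifs with h
  · exact derivWithin_fun_add (hy' h t ht) (hz' h t ht)
  · have hα : α < 1 := lt_of_le_of_ne hα1 h
    have : (∫ s in (0 : ℝ)..t, α * (t - s) ^ (-α - 1) * (y t + z t - (y s + z s)))
        = (∫ s in (0 : ℝ)..t, α * (t - s) ^ (-α - 1) * (y t - y s)) +
          ∫ s in (0 : ℝ)..t, α * (t - s) ^ (-α - 1) * (z t - z s) := by
      rw [← intervalIntegral.integral_add (hy.intervalIntegrable hα ht)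
        (hz.intervalIntegrable hα ht)]
      congr 1; ext s; ring
    rw [this]; ring

theorem caputoDeriv_const_mul (T α : ℝ) (y : ℝ → ℝ) (c t : ℝ) :
    caputoDeriv T α (fun t => c * y t) t = c * caputoDeriv T α y t := by
  unfold caputoDeriv
  split_ifs with h
  · exact derivWithin_const_mul_field c
  · have : (∫ s in (0 : ℝ)..t, α * (t - s) ^ (-α - 1) * (c * y t - c * y s))
        = c * ∫ s in (0 : ℝ)..t, α * (t - s) ^ (-α - 1) * (y t - y s) := by
      rw [← intervalIntegral.integral_const_mul]
      congr 1; ext s; ring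
    rw [this]; ring

/-! ### Minimum principle, comparison and monotonicity -/

theorem derivWithin_Ioc_nonpos_of_forall_le {T t : ℝ} {y : ℝ → ℝ} (ht : t ∈ Ioc 0 T)
    (hmin : ∀ s ∈ Icc 0 t, y t ≤ y s) : derivWithin y (Ioc 0 T) t ≤ 0 := by
  by_cases hd : DifferentiableWithinAt ℝ y (Ioc 0 T) t
  · have h1 : HasDerivWithinAt y (derivWithin y (Ioc 0 T) t) (Ioo 0 t) t :=
      hd.hasDerivWithinAt.mono fun s hs => ⟨hs.1, hs.2.le.trans ht.2⟩
    rw [hasDerivWithinAt_iff_tendsto_slope' (by simp), nhdsWithin_Ioo_eq_nhdsLT ht.1] at h1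
    refine le_of_tendsto h1 ?_
    filter_upwards [Ioo_mem_nhdsLT ht.1] with s hs
    rw [slope_def_field]
    exact div_nonpos_of_nonneg_of_nonpos (sub_nonneg.2 (hmin s ⟨hs.1.le, hs.2.le⟩))
      (sub_nonpos.2 hs.2.le)
  -- Without differentiability the default value `0` still satisfies the bound.
  · rw [derivWithin_zero_of_not_differentiableWithinAt hd]

theorem caputoDeriv_nonpos_of_forall_le {T α t : ℝ} {y : ℝ → ℝ} (hα : 0 < α) (hα1 : α ≤ 1)
    (ht : t ∈ Ioc 0 T) (hmin : ∀ s ∈ Icc 0 t, y t ≤ y s) : caputoDeriv T α y t ≤ 0 := by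
  unfold caputoDeriv
  split_ifs with h
  · exact derivWithin_Ioc_nonpos_of_forall_le ht hmin
  · have hG : 0 < Real.Gamma (1 - α) :=
      Real.Gamma_pos_of_pos (sub_pos.2 (lt_of_le_of_ne hα1 h))
    refine mul_nonpos_of_nonneg_of_nonpos (by positivity) (add_nonpos ?_ ?_)
    · exact mul_nonpos_of_nonneg_of_nonpos (Real.rpow_nonneg ht.1.le _)
        (sub_nonpos.2 (hmin 0 ⟨le_rfl, ht.1.le⟩))
    · rw [← neg_nonneg, ← intervalIntegral.integral_neg]
      refine intervalIntegral.integral_nonneg ht.1.le fun s hs => ?_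
      exact neg_nonneg.2 <| mul_nonpos_of_nonneg_of_nonpos
        (mul_nonneg hα.le (Real.rpow_nonneg (sub_nonneg.2 hs.2) _)) (sub_nonpos.2 (hmin s hs))

/-- Adding `ε t` makes the minimum principle strict. -/
theorem caputoDeriv_id_pos {T α t : ℝ} (hα : 0 < α) (hα1 : α ≤ 1) (ht : t ∈ Ioc 0 T) :
    0 < caputoDeriv T α (fun t => t) t := by
  have ht0 : 0 < t := ht.1
  unfold caputoDeriv
  split_ifs with h
  · rw [derivWithin_id' t _ (uniqueDiffOn_Ioc 0 T t ht)]
    exact one_pos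
  · have hG : 0 < Real.Gamma (1 - α) :=
      Real.Gamma_pos_of_pos (sub_pos.2 (lt_of_le_of_ne hα1 h))
    refine mul_pos (by positivity) (add_pos_of_pos_of_nonneg ?_ ?_)
    · rw [sub_zero]; positivity
    · refine intervalIntegral.integral_nonneg ht.1.le fun s hs => ?_
      exact mul_nonneg
        (mul_nonneg hα.le (Real.rpow_nonneg (sub_nonneg.2 hs.2) _)) (sub_nonneg.2 hs.2)

theorem caputoRegular_id (T : ℝ) : CaputoRegular T (fun t => t) :=
  ContDiffOn.caputoRegular continuousOn_id contDiffOn_id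

/-- Comparison principle for `∑ i, q_i D_t^{α_i} + lam`. -/
theorem nonneg_of_sum_caputoDeriv_nonneg {ι : Type*} [Fintype ι] {T : ℝ} {α : ι → ℝ}
    (hα : ∀ i, 0 < α i ∧ α i ≤ 1) {q : ι → ℝ → ℝ}
    (hq_nonneg : ∀ i, ∀ t ∈ Icc 0 T, 0 ≤ q i t) (hq_sum : ∀ t ∈ Icc 0 T, 0 < ∑ i, q i t)
    {lam : ℝ} (hlam : 0 ≤ lam) {z : ℝ → ℝ} (hz : CaputoRegular T z)
    (hz' : ∀ i, α i = 1 → DifferentiableOn ℝ z (Ioc 0 T)) (hz0 : 0 ≤ z 0)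
    (h : ∀ t ∈ Ioc 0 T, 0 ≤ ∑ i, q i t * caputoDeriv T (α i) z t + lam * z t) :
    ∀ t ∈ Icc 0 T, 0 ≤ z t := by
  intro t₁ ht₁
  by_contra! hneg
  have ht₁0 : 0 < t₁ := lt_of_le_of_ne ht₁.1 (by rintro rfl; linarith)
  -- With this `ε`, `z + ε t` equals `z t₁ / 2 < 0` at `t₁` but is nonnegative at `0`, so its
  -- minimum is not at `0`.
  have hε : 0 < -z t₁ / (2 * t₁) := by
    have : 0 < -z t₁ := by linarith
    positivity
  set ε := -z t₁ / (2 * t₁) with hε_def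
  have hy : CaputoRegular T (fun t => z t + ε * t) := hz.add ((caputoRegular_id T).const_mul ε)
  obtain ⟨t₀, ht₀, hmin⟩ := isCompact_Icc.exists_isMinOn ⟨t₁, ht₁⟩ hy.1
  have hy₁ : z t₁ + ε * t₁ < 0 := by
    have : ε * t₁ = -z t₁ / 2 := by rw [hε_def]; field_simp
    linarith
  have hy₀ : z t₀ + ε * t₀ < 0 := (hmin ht₁).trans_lt hy₁
  have ht₀0 : 0 < t₀ := lt_of_le_of_ne ht₀.1 (by rintro rfl; linarith)
  have ht₀' : t₀ ∈ Ioc 0 T := ⟨ht₀0, ht₀.2⟩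
  have hzt₀ : z t₀ ≤ 0 := by nlinarith [mul_pos hε ht₀0]
  have h1 : ∑ i, q i t₀ * caputoDeriv T (α i) (fun t => z t + ε * t) t₀ ≤ 0 :=
    Finset.sum_nonpos fun i _ => mul_nonpos_of_nonneg_of_nonpos (hq_nonneg i t₀ ht₀)
      (caputoDeriv_nonpos_of_forall_le (hα i).1 (hα i).2 ht₀'
        fun s hs => hmin ⟨hs.1, hs.2.trans ht₀.2⟩)
  have h2 : 0 < ∑ i, q i t₀ * caputoDeriv T (α i) (fun t => t) t₀ := by
    obtain ⟨i, -, hi⟩ := Finset.exists_lt_of_sum_lt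
      (show ∑ i : ι, (0 : ℝ) < ∑ i, q i t₀ by simpa using hq_sum t₀ ht₀)
    refine Finset.sum_pos' (fun i _ => mul_nonneg (hq_nonneg i t₀ ht₀)
      (caputoDeriv_id_pos (hα i).1 (hα i).2 ht₀').le)
      ⟨i, Finset.mem_univ i, mul_pos hi (caputoDeriv_id_pos (hα i).1 (hα i).2 ht₀')⟩
  have h3 : ∑ i, q i t₀ * caputoDeriv T (α i) (fun t => z t + ε * t) t₀ =
      ∑ i, q i t₀ * caputoDeriv T (α i) z t₀ +
        ε * ∑ i, q i t₀ * caputoDeriv T (α i) (fun t => t) t₀ := by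
    rw [Finset.mul_sum, ← Finset.sum_add_distrib]
    refine Finset.sum_congr rfl fun i _ => ?_
    rw [caputoDeriv_add (hα i).2 hz ((caputoRegular_id T).const_mul ε) (hz' i)
      (fun _ => (differentiable_id.const_mul ε).differentiableOn) ht₀', caputoDeriv_const_mul]
    ring
  have h4 := h t₀ ht₀'
  have h5 : lam * z t₀ ≤ 0 := mul_nonpos_of_nonneg_of_nonpos hlam hzt₀
  have h6 := mul_pos hε h2
  linarith

/-- A solution of the relaxation equation `D_t^α u = -c u` is nonincreasing. -/
theorem antitoneOn_of_caputoDeriv_eq {T α c : ℝ} (hα : 0 < α) (hα1 : α < 1) (hc : 0 < c)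
    {u : ℝ → ℝ} (hu : CaputoRegular T u) (hu0 : 0 ≤ u 0)
    (h : ∀ t ∈ Ioc 0 T, caputoDeriv T α u t = -c * u t) : AntitoneOn u (Icc 0 T) := by
  intro a ha b hb hab
  by_contra! hlt
  obtain ⟨t₁, ht₁, hmin⟩ := isCompact_Icc.exists_isMinOn ⟨b, hb.1, le_rfl⟩
    (hu.1.mono (Icc_subset_Icc_right hb.2))
  have hu₁ : u t₁ < u b := (hmin ⟨ha.1, hab⟩).trans_lt hlt
  obtain ⟨t₂, ht₂, hmax⟩ := isCompact_Icc.exists_isMaxOn ⟨b, ht₁.2, le_rfl⟩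
    (hu.1.mono (Icc_subset_Icc ht₁.1 hb.2))
  have hu₁₂ : u t₁ < u t₂ := hu₁.trans_le (hmax ⟨ht₁.2, le_rfl⟩)
  have ht₁₂ : t₁ < t₂ := lt_of_le_of_ne ht₂.1 (by rintro rfl; exact hu₁₂.false)
  have ht₂0 : 0 < t₂ := ht₁.1.trans_lt ht₁₂
  have ht₂' : t₂ ∈ Ioc 0 T := ⟨ht₂0, ht₂.2.trans hb.2⟩
  have hG : 0 < (Real.Gamma (1 - α))⁻¹ := inv_pos.2 (Real.Gamma_pos_of_pos (sub_pos.2 hα1))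
  rcases ht₁.1.eq_or_lt with rfl | ht₁0
  -- If `t₁ = 0`, then `t₂` is a maximum over its whole past, so `D^α u(t₂) ≥ 0`, against `-c u(t₂)
  -- < 0`.
  · have h1 : caputoDeriv T α (fun t => -1 * u t) t₂ ≤ 0 :=
      caputoDeriv_nonpos_of_forall_le hα hα1.le ht₂' fun s hs => by
        have : u s ≤ u t₂ := hmax ⟨hs.1, hs.2.trans ht₂.2⟩
        linarith
    rw [caputoDeriv_const_mul, h t₂ ht₂'] at h1
    have : 0 < c * u t₂ := mul_pos hc (by linarith)
    linarith
  · have ht₁' : t₁ ∈ Ioc 0 T := ⟨ht₁0, ht₁.2.trans hb.2⟩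
    have h1 := h t₁ ht₁'
    have h2 := h t₂ ht₂'
    -- The equation orders the derivatives one way, the formula the other: on `[0, t₁]` the
    -- differences `u t₁ - u s` are nonpositive, and passing to `t₂` raises them and shrinks their
    -- weights; `[t₁, t₂]` contributes a nonnegative integral.
    have hlt : caputoDeriv T α u t₂ < caputoDeriv T α u t₁ := by
      rw [h1, h2]; nlinarith
    refine hlt.not_ge ?_
    unfold caputoDeriv
    rw [if_neg hα1.ne, if_neg hα1.ne]
    have hi₁ := hu.intervalIntegrable hα1 ht₁'
    have hi₂ := hu.intervalIntegrable hα1 ht₂'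
    have hi₂₁ : IntervalIntegrable (fun s => α * (t₂ - s) ^ (-α - 1) * (u t₂ - u s))
        MeasureTheory.volume 0 t₁ := hi₂.mono_set (by
      rw [uIcc_of_le ht₁.1, uIcc_of_le ht₂0.le]; exact Icc_subset_Icc_right ht₂.1)
    have hi₂₂ : IntervalIntegrable (fun s => α * (t₂ - s) ^ (-α - 1) * (u t₂ - u s))
        MeasureTheory.volume t₁ t₂ := hi₂.mono_set (by
      rw [uIcc_of_le ht₂.1, uIcc_of_le ht₂0.le]; exact Icc_subset_Icc_left ht₁.1)
    have key : ∀ {r : ℝ}, r ≤ 0 → ∀ s ∈ Ico 0 t₁, ∀ {x y : ℝ}, x ≤ y → x ≤ 0 →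
        (t₁ - s) ^ r * x ≤ (t₂ - s) ^ r * y := by
      intro r hr s hs x y hxy hx
      have hp : 0 < t₁ - s := sub_pos.2 hs.2
      have h3 : (t₂ - s) ^ r ≤ (t₁ - s) ^ r :=
        Real.rpow_le_rpow_of_nonpos hp (by linarith) hr
      have h4 : 0 ≤ (t₂ - s) ^ r := Real.rpow_nonneg (by linarith) _
      nlinarith
    refine mul_le_mul_of_nonneg_left (add_le_add ?_ ?_) hG.le
    · have := key (r := -α) (by linarith) 0 ⟨le_rfl, ht₁0⟩ (x := u t₁ - u 0) (y := u t₂ - u 0)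
        (by linarith) (sub_nonpos.2 (hmin ⟨le_rfl, hb.1⟩))
      simpa using this
    · rw [← intervalIntegral.integral_add_adjacent_intervals hi₂₁ hi₂₂]
      have h3 : 0 ≤ ∫ s in t₁..t₂, α * (t₂ - s) ^ (-α - 1) * (u t₂ - u s) :=
        intervalIntegral.integral_nonneg ht₂.1 fun s hs => mul_nonneg
          (mul_nonneg hα.le (Real.rpow_nonneg (sub_nonneg.2 hs.2) _))
          (sub_nonneg.2 (hmax ⟨hs.1, hs.2.trans ht₂.2⟩))
      have h4 : (∫ s in (0 : ℝ)..t₁, α * (t₁ - s) ^ (-α - 1) * (u t₁ - u s)) ≤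
          ∫ s in (0 : ℝ)..t₁, α * (t₂ - s) ^ (-α - 1) * (u t₂ - u s) := by
        refine intervalIntegral.integral_mono_on_of_le_Ioo ht₁.1 hi₁ hi₂₁ fun s hs => ?_
        rw [mul_assoc, mul_assoc]
        refine mul_le_mul_of_nonneg_left (key (by linarith) s ⟨hs.1.le, hs.2⟩ (by linarith)
          (sub_nonpos.2 (hmin ⟨hs.1.le, hs.2.le.trans ht₁.2⟩))) hα.le
      linarith

/-! ### The Mittag-Leffler series -/

/-- Keep only `x > R` in the Gamma integral, where `x^s ≥ R^s`. -/
theorem rpow_mul_exp_neg_le_Gamma {s R : ℝ} (hs : 0 ≤ s) (hR : 0 ≤ R) :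
    R ^ s * Real.exp (-R) ≤ Real.Gamma (s + 1) := by
  have hconv := Real.GammaIntegral_convergent (s := s + 1) (by linarith)
  have hsub : Ioi R ⊆ Ioi 0 := Ioi_subset_Ioi hR
  rw [Real.Gamma_eq_integral (by linarith), ← integral_exp_neg_Ioi R,
    ← MeasureTheory.integral_const_mul]
  refine le_trans (MeasureTheory.setIntegral_mono_on ?_ (hconv.mono_set hsub) measurableSet_Ioi
    fun x hx => ?_) (MeasureTheory.setIntegral_mono_set hconv ?_ hsub.eventuallyLE)
  · exact (integrableOn_exp_neg_Ioi R).const_mul _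
  · have hx' : R < x := hx
    rw [mul_comm, add_sub_cancel_right]
    gcongr
  · refine (MeasureTheory.ae_restrict_iff' measurableSet_Ioi).2 (.of_forall fun x hx => ?_)
    have hx' : 0 < x := hx
    simp only [Pi.zero_apply]
    positivity

theorem summable_pow_div_Gamma {α : ℝ} (hα : 0 < α) (x : ℝ) :
    Summable fun k : ℕ => x ^ k / Real.Gamma (α * k + 1) := by
  -- With `R^α = b`, `Γ(αk + 1) ≥ b^k e^(-R)`; since `b ≥ 2|x|`, the terms are at most `e^R 2^(-k)`.
  set b : ℝ := 2 * |x| + 1 with hb_def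
  have hb : 0 < b := by positivity
  set R : ℝ := b ^ α⁻¹ with hR
  have hR0 : 0 < R := by positivity
  have hRα : R ^ α = b := by rw [hR, ← Real.rpow_mul hb.le, inv_mul_cancel₀ hα.ne', Real.rpow_one]
  refine Summable.of_norm_bounded (g := fun k : ℕ => Real.exp R * (1 / 2) ^ k)
    (summable_geometric_two.mul_left _) fun k => ?_
  have hk : (0 : ℝ) ≤ α * k := by positivity
  have hG : 0 < Real.Gamma (α * k + 1) := Real.Gamma_pos_of_pos (by linarith)
  have h1 := rpow_mul_exp_neg_le_Gamma hk hR0.le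
  rw [Real.rpow_mul hR0.le, hRα, Real.rpow_natCast, Real.exp_neg] at h1
  rw [norm_div, norm_pow, Real.norm_eq_abs, Real.norm_eq_abs, abs_of_pos hG, div_le_iff₀ hG]
  calc |x| ^ k ≤ (b / 2) ^ k := by gcongr; linarith
    _ = Real.exp R * (1 / 2) ^ k * (b ^ k * (Real.exp R)⁻¹) := by
      field_simp
      rw [← mul_pow]; ring_nf
    _ ≤ _ := by gcongr

theorem hasSum_mittagLeffler {α : ℝ} (hα : 0 < α) (x : ℝ) :
    HasSum (fun k : ℕ => x ^ k / Real.Gamma (α * k + 1)) (mittagLeffler α 1 x) :=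
  (summable_pow_div_Gamma hα x).hasSum

theorem mittagLeffler_zero_right {α : ℝ} (hα : 0 < α) : mittagLeffler α 1 0 = 1 := by
  refine (hasSum_mittagLeffler hα 0).unique ?_
  convert hasSum_single (f := fun k : ℕ => (0 : ℝ) ^ k / Real.Gamma (α * k + 1)) 0 ?_
  · simp
  · intro k hk
    simp [hk]

theorem mittagLeffler_one_one (x : ℝ) : mittagLeffler 1 1 x = Real.exp x := by
  rw [Real.exp_eq_exp_ℝ, NormedSpace.exp_eq_tsum_div]
  refine tsum_congr fun k => ?_
  rw [one_mul, Real.Gamma_nat_eq_factorial]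

theorem contDiff_mittagLeffler {α : ℝ} (hα : 0 < α) : ContDiff ℝ 1 (mittagLeffler α 1) := by
  set p := FormalMultilinearSeries.ofScalars ℝ (fun k : ℕ => (Real.Gamma (α * k + 1))⁻¹) with hp
  have hrad : p.radius = ⊤ := by
    refine p.radius_eq_top_of_summable_norm fun r => ?_
    refine (summable_pow_div_Gamma hα r).congr fun k => ?_
    have hG : 0 < Real.Gamma (α * k + 1) := Real.Gamma_pos_of_pos (by positivity)
    rw [hp, FormalMultilinearSeries.ofScalars_norm, norm_inv, Real.norm_eq_abs, abs_of_pos hG]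
    ring
  have hsum : mittagLeffler α 1 = p.sum := by
    ext x
    refine tsum_congr fun k => ?_
    rw [hp, FormalMultilinearSeries.ofScalars_apply_eq, smul_eq_mul]
    ring
  have h := p.hasFPowerSeriesOnBall (by rw [hrad]; exact ENNReal.zero_lt_top)
  rw [hrad] at h
  rw [hsum]
  refine contDiff_iff_contDiffAt.2 fun x => ?_
  exact (h.analyticAt_of_mem (by simp)).contDiffAt

theorem contDiffOn_mittagLeffler_rpow {α : ℝ} (hα : 0 < α) (c : ℝ) :
    ContDiffOn ℝ 1 (fun t => mittagLeffler α 1 (-c * t ^ α)) (Ioi 0) := by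
  refine (contDiff_mittagLeffler hα).comp_contDiffOn (contDiffOn_const.mul ?_)
  exact contDiffOn_id.rpow_const_of_ne fun t ht => (mem_Ioi.1 ht).ne'

theorem caputoRegular_mittagLeffler_rpow {α : ℝ} (hα : 0 < α) (c T : ℝ) :
    CaputoRegular T (fun t => mittagLeffler α 1 (-c * t ^ α)) := by
  refine ContDiffOn.caputoRegular ?_ (contDiffOn_mittagLeffler_rpow hα c)
  exact ((contDiff_mittagLeffler hα).continuous.comp
    (continuous_const.mul (Real.continuous_rpow_const hα.le))).continuousOn

theorem caputoRegular_rpow {β : ℝ} (hβ : 0 < β) (T : ℝ) : CaputoRegular T (fun t => t ^ β) :=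
  ContDiffOn.caputoRegular (Real.continuous_rpow_const hβ.le).continuousOn
    (contDiffOn_id.rpow_const_of_ne fun _ ht => (mem_Ioi.1 ht).ne')

/-! ### Caputo derivatives of powers and of the barrier -/

theorem integral_rpow_mul_sub_rpow {a b t : ℝ} (ha : 0 < a) (hb : 0 < b) (ht : 0 < t) :
    ∫ s in (0 : ℝ)..t, s ^ (a - 1) * (t - s) ^ (b - 1) =
      t ^ (a + b - 1) * (Real.Gamma a * Real.Gamma b / Real.Gamma (a + b)) := by
  have h := Complex.betaIntegral_scaled (a : ℂ) (b : ℂ) ht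
  rw [Complex.betaIntegral_eq_Gamma_mul_div _ _ (by simpa) (by simpa), ← Complex.ofReal_add,
    Complex.Gamma_ofReal, Complex.Gamma_ofReal, Complex.Gamma_ofReal] at h
  rw [← Complex.ofReal_inj, ← intervalIntegral.integral_ofReal]
  rw [Complex.ofReal_mul, Complex.ofReal_cpow ht.le]
  push_cast at h ⊢
  rw [← h]
  refine intervalIntegral.integral_congr fun s hs => ?_
  rw [uIcc_of_le ht.le] at hs
  rw [← Complex.ofReal_one, ← Complex.ofReal_sub, ← Complex.ofReal_sub, ← Complex.ofReal_sub,
    ← Complex.ofReal_cpow hs.1, ← Complex.ofReal_cpow (sub_nonneg.2 hs.2)]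

theorem intervalIntegrable_rpow_mul_sub_rpow {a b t : ℝ} (ha : 0 < a) (hb : 0 < b) (ht : 0 < t) :
    IntervalIntegrable (fun s => s ^ (a - 1) * (t - s) ^ (b - 1)) MeasureTheory.volume 0 t := by
  -- A non-integrable function would have integral `0` by default, but the Beta value is positive.
  by_contra h
  have h1 := intervalIntegral.integral_undef h
  rw [integral_rpow_mul_sub_rpow ha hb ht] at h1
  have := Real.Gamma_pos_of_pos ha
  have := Real.Gamma_pos_of_pos hb
  have := Real.Gamma_pos_of_pos (add_pos ha hb)
  exact absurd h1 (by positivity)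

/-- Integration by parts reduces this to a Beta integral. The boundary term at `s = t` vanishes,
being `O((t - s)^(1 - α))`; the one at `s = 0` later cancels the `t^(-α)` term of the Caputo
formula. -/
theorem integral_caputo_rpow {α β t : ℝ} (hα1 : α < 1) (hβ : 0 < β) (ht : 0 < t) :
    ∫ s in (0 : ℝ)..t, α * (t - s) ^ (-α - 1) * (t ^ β - s ^ β) =
      Real.Gamma (1 - α) * (Real.Gamma (β + 1) / Real.Gamma (β - α + 1) * t ^ (β - α))
        - t ^ (-α) * t ^ β := by
  have hreg := caputoRegular_rpow hβ t
  have htt : t ∈ Ioc 0 t := ⟨ht, le_rfl⟩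
  have hi₁ := hreg.intervalIntegrable hα1 htt
  have hi₂ := (intervalIntegrable_rpow_mul_sub_rpow hβ (sub_pos.2 hα1) ht).const_mul β
  obtain ⟨K, hK0, hK⟩ := hreg.exists_abs_sub_le htt
  have hcont : ContinuousOn (fun s => (t - s) ^ (-α) * (t ^ β - s ^ β)) (Icc 0 t) := by
    intro s hs
    rcases hs.2.eq_or_lt with rfl | hst
    · rw [ContinuousWithinAt, sub_self (s ^ β), mul_zero]
      refine squeeze_zero_norm' (a := fun r => K * (s - r) ^ (1 - α)) ?_ ?_
      · filter_upwards [self_mem_nhdsWithin] with r hr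
        rw [norm_mul, Real.norm_eq_abs, Real.norm_eq_abs,
          abs_of_nonneg (Real.rpow_nonneg (sub_nonneg.2 hr.2) _)]
        rcases hr.2.eq_or_lt with rfl | hrs
        · rw [sub_self (r ^ β), abs_zero, mul_zero]
          exact mul_nonneg hK0 (Real.rpow_nonneg (sub_self r).ge _)
        · rw [sub_eq_add_neg 1 α, add_comm, Real.rpow_add_one (sub_pos.2 hrs).ne',
            mul_left_comm]
          exact mul_le_mul_of_nonneg_left (hK r hr) (Real.rpow_nonneg (sub_nonneg.2 hr.2) _)
      · have : Continuous fun r : ℝ => K * (s - r) ^ (1 - α) :=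
          continuous_const.mul ((continuous_const.sub continuous_id).rpow_const
            fun _ => Or.inr (sub_pos.2 hα1).le)
        refine (this.tendsto' s 0 ?_).mono_left nhdsWithin_le_nhds
        rw [sub_self, Real.zero_rpow (sub_pos.2 hα1).ne', mul_zero]
    · refine ContinuousAt.continuousWithinAt ?_
      exact ((continuousAt_const.sub continuousAt_id).rpow_const
        (Or.inl (sub_pos.2 hst).ne')).mul
        (continuousAt_const.sub (Real.continuousAt_rpow_const _ _ (Or.inr hβ.le)))
  have hderiv : ∀ s ∈ Ioo 0 t, HasDerivAt (fun s => (t - s) ^ (-α) * (t ^ β - s ^ β))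
      (α * (t - s) ^ (-α - 1) * (t ^ β - s ^ β)
        - β * (s ^ (β - 1) * (t - s) ^ (1 - α - 1))) s := by
    intro s hs
    have h1 : HasDerivAt (fun s => (t - s) ^ (-α)) (-1 * (-α) * (t - s) ^ (-α - 1)) s :=
      ((hasDerivAt_id s).const_sub t).rpow_const (Or.inl (sub_pos.2 hs.2).ne')
    have h2 : HasDerivAt (fun s => t ^ β - s ^ β) (-(β * s ^ (β - 1))) s :=
      (Real.hasDerivAt_rpow_const (Or.inl hs.1.ne')).const_sub _
    refine (h1.mul h2).congr_deriv ?_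
    rw [show 1 - α - 1 = -α by ring]
    ring
  have hFTC := intervalIntegral.integral_eq_sub_of_hasDerivAt_of_le ht.le hcont hderiv
    (hi₁.sub hi₂)
  rw [intervalIntegral.integral_sub hi₁ hi₂, intervalIntegral.integral_const_mul,
    integral_rpow_mul_sub_rpow hβ (sub_pos.2 hα1) ht, sub_self (t ^ β), mul_zero, sub_zero,
    Real.zero_rpow hβ.ne', sub_zero] at hFTC
  rw [sub_eq_iff_eq_add.1 hFTC, Real.Gamma_add_one hβ.ne',
    show β + (1 - α) - 1 = β - α by ring, show β + (1 - α) = β - α + 1 by ring]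
  ring

theorem caputoDeriv_mittagLeffler_rpow {α : ℝ} (hα : 0 < α) (hα1 : α < 1) (c T : ℝ) {t : ℝ}
    (ht : 0 < t) :
    caputoDeriv T α (fun t => mittagLeffler α 1 (-c * t ^ α)) t =
      -c * mittagLeffler α 1 (-c * t ^ α) := by
  have hG : 0 < Real.Gamma (1 - α) := Real.Gamma_pos_of_pos (sub_pos.2 hα1)
  have hpow : ∀ (b s : ℝ) (k : ℕ), 0 ≤ s → (b * s ^ α) ^ k = b ^ k * s ^ (α * k) := by
    intro b s k hs
    rw [mul_pow, Real.rpow_mul hs, Real.rpow_natCast]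
  -- The constant term drops out of differences, hence the index `k + 1`. A general `b` serves both
  -- `-c`, for the value, and `|c|`, for the norms that justify exchanging sum and integral.
  have hsum : ∀ b s : ℝ, 0 ≤ s → HasSum
      (fun k : ℕ => b ^ (k + 1) / Real.Gamma (α * (k + 1 : ℕ) + 1) * s ^ (α * (k + 1 : ℕ)))
      (mittagLeffler α 1 (b * s ^ α) - 1) := by
    intro b s hs
    have := (hasSum_nat_add_iff' 1).2 (hasSum_mittagLeffler hα (b * s ^ α))
    simp only [Finset.sum_range_one, pow_zero, Nat.cast_zero, mul_zero, zero_add,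
      Real.Gamma_one, div_one] at this
    refine this.congr_fun fun k => ?_
    rw [hpow _ _ _ hs]
    ring
  set F : ℕ → ℝ → ℝ := fun k s => (-c) ^ (k + 1) / Real.Gamma (α * (k + 1 : ℕ) + 1) *
    (α * (t - s) ^ (-α - 1) * (t ^ (α * (k + 1 : ℕ)) - s ^ (α * (k + 1 : ℕ)))) with hF
  have hβ : ∀ k : ℕ, 0 < α * (k + 1 : ℕ) := fun k => by positivity
  have hFint : ∀ k, IntervalIntegrable (F k) MeasureTheory.volume 0 t := fun k =>
    ((caputoRegular_rpow (hβ k) t).intervalIntegrable hα1 ⟨ht, le_rfl⟩).const_mul _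
  have hval : ∀ (b : ℝ) (k : ℕ), b ^ (k + 1) / Real.Gamma (α * (k + 1 : ℕ) + 1) *
      ∫ s in (0 : ℝ)..t, α * (t - s) ^ (-α - 1) * (t ^ (α * (k + 1 : ℕ)) - s ^ (α * (k + 1 : ℕ)))
      = b * Real.Gamma (1 - α) * ((b * t ^ α) ^ k / Real.Gamma (α * k + 1))
        - t ^ (-α) * (b ^ (k + 1) / Real.Gamma (α * (k + 1 : ℕ) + 1) * t ^ (α * (k + 1 : ℕ))) := by
    intro b k
    have hG' : 0 < Real.Gamma (α * (k + 1 : ℕ) + 1) := Real.Gamma_pos_of_pos (by positivity)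
    rw [integral_caputo_rpow hα1 (hβ k) ht, hpow _ _ _ ht.le,
      show α * (k + 1 : ℕ) - α = α * k by push_cast; ring]
    field_simp
    ring
  have hvalsum : ∀ b : ℝ, HasSum (fun k : ℕ => b ^ (k + 1) / Real.Gamma (α * (k + 1 : ℕ) + 1) *
      ∫ s in (0 : ℝ)..t, α * (t - s) ^ (-α - 1) * (t ^ (α * (k + 1 : ℕ)) - s ^ (α * (k + 1 : ℕ))))
      (b * Real.Gamma (1 - α) * mittagLeffler α 1 (b * t ^ α)
        - t ^ (-α) * (mittagLeffler α 1 (b * t ^ α) - 1)) := by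
    intro b
    simp_rw [hval]
    exact ((hasSum_mittagLeffler hα (b * t ^ α)).mul_left _).sub ((hsum b t ht.le).mul_left _)
  have hnorm : ∀ k, ∫ s in Ioc 0 t, ‖F k s‖ = |c| ^ (k + 1) / Real.Gamma (α * (k + 1 : ℕ) + 1) *
      ∫ s in (0 : ℝ)..t, α * (t - s) ^ (-α - 1) *
        (t ^ (α * (k + 1 : ℕ)) - s ^ (α * (k + 1 : ℕ))) := by
    intro k
    rw [← intervalIntegral.integral_const_mul, intervalIntegral.integral_of_le ht.le]
    refine MeasureTheory.setIntegral_congr_fun measurableSet_Ioc fun s hs => ?_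
    have hG' : 0 < Real.Gamma (α * (k + 1 : ℕ) + 1) := Real.Gamma_pos_of_pos (by positivity)
    have h1 : s ^ (α * (k + 1 : ℕ)) ≤ t ^ (α * (k + 1 : ℕ)) :=
      Real.rpow_le_rpow hs.1.le hs.2 (hβ k).le
    have h2 : 0 ≤ α * (t - s) ^ (-α - 1) * (t ^ (α * (k + 1 : ℕ)) - s ^ (α * (k + 1 : ℕ))) :=
      mul_nonneg (mul_nonneg hα.le (Real.rpow_nonneg (sub_nonneg.2 hs.2) _)) (sub_nonneg.2 h1)
    simp only [hF]
    rw [norm_mul, Real.norm_of_nonneg h2, norm_div, norm_pow, norm_neg, Real.norm_eq_abs,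
      Real.norm_of_nonneg hG'.le]
  have hmain := MeasureTheory.hasSum_integral_of_summable_integral_norm
    (μ := MeasureTheory.volume.restrict (Ioc 0 t)) (F := F)
    (fun k => (intervalIntegrable_iff_integrableOn_Ioc_of_le ht.le).1 (hFint k))
    ((hvalsum |c|).summable.congr fun k => (hnorm k).symm)
  have hint : ∫ s in (0 : ℝ)..t, α * (t - s) ^ (-α - 1) *
      (mittagLeffler α 1 (-c * t ^ α) - mittagLeffler α 1 (-c * s ^ α)) =
      ∫ s in Ioc 0 t, ∑' k, F k s := by
    rw [intervalIntegral.integral_of_le ht.le]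
    refine MeasureTheory.setIntegral_congr_fun measurableSet_Ioc fun s hs => ?_
    have h1 := (((hsum (-c) t ht.le).sub (hsum (-c) s hs.1.le)).mul_left
      (α * (t - s) ^ (-α - 1)))
    rw [sub_sub_sub_cancel_right] at h1
    refine (h1.congr_fun fun k => ?_).tsum_eq.symm
    simp only [hF]
    ring
  have hval' : ∫ s in Ioc 0 t, ∑' k, F k s =
      -c * Real.Gamma (1 - α) * mittagLeffler α 1 (-c * t ^ α)
        - t ^ (-α) * (mittagLeffler α 1 (-c * t ^ α) - 1) := by
    refine hmain.unique ((hvalsum (-c)).congr_fun fun k => ?_)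
    rw [← intervalIntegral.integral_of_le ht.le, ← intervalIntegral.integral_const_mul]
  unfold caputoDeriv
  rw [if_neg hα1.ne, hint, hval']
  simp only [Real.zero_rpow hα.ne', mul_zero, mittagLeffler_zero_right hα]
  field_simp
  ring

theorem antitoneOn_mittagLeffler_rpow {α c : ℝ} (hα : 0 < α) (hα1 : α ≤ 1) (hc : 0 ≤ c) (T : ℝ) :
    AntitoneOn (fun t => mittagLeffler α 1 (-c * t ^ α)) (Icc 0 T) := by
  rcases hα1.eq_or_lt with rfl | hα1
  · intro a _ b _ hab
    simp only [mittagLeffler_one_one, Real.rpow_one]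
    refine Real.exp_le_exp.2 ?_
    nlinarith
  rcases hc.eq_or_lt with rfl | hc
  · intro a _ b _ _
    simp
  · refine antitoneOn_of_caputoDeriv_eq hα hα1 hc (caputoRegular_mittagLeffler_rpow hα c T) ?_
      fun t ht => caputoDeriv_mittagLeffler_rpow hα hα1 c T ht.1
    rw [Real.zero_rpow hα.ne', mul_zero, mittagLeffler_zero_right hα]
    exact zero_le_one

theorem caputoDeriv_one_mittagLeffler (c T : ℝ) {t : ℝ} (ht : t ∈ Ioc 0 T) :
    caputoDeriv T 1 (fun t => mittagLeffler 1 1 (-c * t ^ (1 : ℝ))) t =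
      -c * mittagLeffler 1 1 (-c * t ^ (1 : ℝ)) := by
  simp only [caputoDeriv, if_true, mittagLeffler_one_one, Real.rpow_one]
  have h : HasDerivAt (fun t => Real.exp (-c * t)) (Real.exp (-c * t) * (-c * 1)) t :=
    ((hasDerivAt_id t).const_mul (-c)).exp
  rw [h.hasDerivWithinAt.derivWithin (uniqueDiffOn_Ioc 0 T t ht)]
  ring

/-! ### The barrier argument -/

theorem theorem2p5 {ℓ : ℕ} [NeZero ℓ] (T : ℝ) (hT : 0 < T)
    (α : Fin ℓ → ℝ) (hα_anti : StrictAnti α) (hα : ∀ i, 0 < α i ∧ α i ≤ 1)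
    (q : Fin ℓ → ℝ → ℝ) (hq_cont : ∀ i, ContinuousOn (q i) (Set.Icc 0 T))
    (hq_nonneg : ∀ i, ∀ t ∈ Set.Icc 0 T, 0 ≤ q i t)
    (hq_sum : ∀ t ∈ Set.Icc 0 T, 0 < ∑ i, q i t)
    (lam : ℝ) (hlam : 0 ≤ lam)
    (v : ℝ → ℝ) (hv_cont : ContinuousOn v (Set.Icc 0 T)) (hv_nonneg : ∀ t ∈ Set.Icc 0 T, 0 ≤ v t)
    (w₀ : ℝ) (hw₀ : 0 ≤ w₀)
    (w : ℝ → ℝ) (hw_reg : CaputoRegular T w)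
    (hw_C1 : α 0 = 1 → ContDiffOn ℝ 1 w (Set.Ioc 0 T))
    (hw : SolvesIVP T α q lam v w₀ w) :
    ∀ t ∈ Set.Icc 0 T,
      w₀ * Finset.univ.sup' Finset.univ_nonempty
          (fun j => lowerBarrier (α j) lam (minValue T (q j)) t) ≤ w t := by
  intro t ht
  -- `α 0` is the largest order, so `α i = 1` forces `α 0 = 1`.
  have hw' : ∀ i, α i = 1 → DifferentiableOn ℝ w (Ioc 0 T) := fun i hi =>
    (hw_C1 (le_antisymm (hα 0).2 (hi ▸ hα_anti.antitone (Fin.zero_le i)))).differentiableOn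
      one_ne_zero
  obtain ⟨j, -, hj⟩ := Finset.exists_mem_eq_sup' Finset.univ_nonempty
    (fun j => lowerBarrier (α j) lam (minValue T (q j)) t)
  rw [hj, lowerBarrier]
  obtain ⟨⟨t', ht', hqt'⟩, hmin⟩ := minValue_isLeast hT.le (hq_cont j)
  split_ifs with hm
  -- For `m = 0` the claim is `w ≥ 0`: comparison applied to `w` itself.
  · rw [mul_zero]
    refine nonneg_of_sum_caputoDeriv_nonneg hα hq_nonneg hq_sum hlam hw_reg hw'
      (hw.2 ▸ hw₀) (fun s hs => ?_) t ht
    rw [hw.1 s hs]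
    exact hv_nonneg s (Ioc_subset_Icc_self hs)
  set m := minValue T (q j) with hm_def
  have hm0 : 0 < m := lt_of_le_of_ne (hqt' ▸ hq_nonneg j t' ht') (Ne.symm hm)
  set c := lam / m with hc_def
  have hc : 0 ≤ c := by positivity
  have hcm : m * c = lam := by rw [hc_def]; field_simp
  set u : ℝ → ℝ := fun t => mittagLeffler (α j) 1 (-c * t ^ α j) with hu_def
  have hu : CaputoRegular T u := caputoRegular_mittagLeffler_rpow (hα j).1 c T
  have hud : DifferentiableOn ℝ u (Ioc 0 T) :=
    ((contDiffOn_mittagLeffler_rpow (hα j).1 c).differentiableOn one_ne_zero).mono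
      fun s hs => hs.1
  have hu0 : u 0 = 1 := by
    simp only [hu_def]
    rw [Real.zero_rpow (hα j).1.ne', mul_zero, mittagLeffler_zero_right (hα j).1]
  have hanti : AntitoneOn u (Icc 0 T) := antitoneOn_mittagLeffler_rpow (hα j).1 (hα j).2 hc T
  have hDu : ∀ i, ∀ s ∈ Ioc 0 T, caputoDeriv T (α i) u s ≤ 0 := fun i s hs =>
    caputoDeriv_nonpos_of_forall_le (hα i).1 (hα i).2 hs fun r hr =>
      hanti ⟨hr.1, hr.2.trans hs.2⟩ (Ioc_subset_Icc_self hs) hr.2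
  have hDuj : ∀ s ∈ Ioc 0 T, caputoDeriv T (α j) u s = -c * u s := by
    intro s hs
    rcases (hα j).2.eq_or_lt with h1 | h1
    · simp only [hu_def, h1]
      exact caputoDeriv_one_mittagLeffler c T hs
    · exact caputoDeriv_mittagLeffler_rpow (hα j).1 h1 c T hs.1
  have hLu : ∀ s ∈ Ioc 0 T, ∑ i, q i s * caputoDeriv T (α i) u s + lam * u s ≤ 0 := by
    intro s hs
    have hs' := Ioc_subset_Icc_self hs
    have h1 : ∑ i, q i s * caputoDeriv T (α i) u s ≤ q j s * caputoDeriv T (α j) u s := by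
      rw [← Finset.add_sum_erase _ _ (Finset.mem_univ j)]
      have : ∑ i ∈ Finset.univ.erase j, q i s * caputoDeriv T (α i) u s ≤ 0 :=
        Finset.sum_nonpos fun i _ =>
          mul_nonpos_of_nonneg_of_nonpos (hq_nonneg i s hs') (hDu i s hs)
      linarith
    have h2 : q j s * caputoDeriv T (α j) u s ≤ m * caputoDeriv T (α j) u s :=
      mul_le_mul_of_nonpos_right (hmin (mem_image_of_mem _ hs')) (hDu j s hs)
    have h3 : m * caputoDeriv T (α j) u s = -(lam * u s) := by
      rw [hDuj s hs, ← hcm]; ring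
    linarith
  have key := nonneg_of_sum_caputoDeriv_nonneg hα hq_nonneg hq_sum hlam
    (hw_reg.add (hu.const_mul (-w₀)))
    (fun i hi => (hw' i hi).add (hud.const_mul (-w₀)))
    (by rw [hw.2, hu0]; linarith) (fun s hs => ?_) t ht
  · have harg : -lam * t ^ α j / m = -c * t ^ α j := by rw [hc_def]; ring
    rw [harg]
    have : 0 ≤ w t + -w₀ * mittagLeffler (α j) 1 (-c * t ^ α j) := key
    linarith
  · have h1 : ∑ i, q i s * caputoDeriv T (α i) (fun t => w t + -w₀ * u t) s =
        ∑ i, q i s * caputoDeriv T (α i) w s +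
          -w₀ * ∑ i, q i s * caputoDeriv T (α i) u s := by
      rw [Finset.mul_sum, ← Finset.sum_add_distrib]
      refine Finset.sum_congr rfl fun i _ => ?_
      rw [caputoDeriv_add (hα i).2 hw_reg (hu.const_mul (-w₀)) (hw' i)
        (fun _ => hud.const_mul (-w₀)) hs, caputoDeriv_const_mul]
      ring
    have h2 := hw.1 s hs
    have h3 := hv_nonneg s (Ioc_subset_Icc_self hs)
    have h4 := mul_nonneg hw₀ (neg_nonneg.2 (hLu s hs))
    rw [h1]
    linarith
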